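/- Let $\mathcal Q_0,\tilde{\mathcal Q}_2,\mathcal U,\mathcal S,\mathcal X$ be finite alphabets, let $p(q_0,\tilde q_2)$ be a probability mass function on $\mathcal Q_0\times\tilde{\mathcal Q}_2$ and let $p(x\mid s,q_0)$ be a conditional probability mass function. Consider the semantic channel with noiseless physical channel in which the context $(Q_{0,i},\tilde Q_{2,i})_{i\le n}$ is i.i.d. with law $p(q_0,\tilde q_2)$; the sender knows the whole sequence $Q_1^n=Q_0^n$ and the receiver knows the whole sequence $Q_2^n=(Q_0^n,\tilde Q_2^n)$, so that the sender's context is part of the receiver's. A code of block length $n$ for $M$ semantics consists of an encoder $(w,q_0^n)\mapsto s^n\in\mathcal S^n$ and a decoder $(x^n,q_0^n,\tilde q_2^n)\mapsto\hat w$. Given the semantic codeword $s^n$ and the context, the sender produces the message codeword $X^n$ with law $\prod_{i=1}^n p(x_i\mid s_i,q_{0,i})$, and $X^n$ reaches the receiver undistorted. A rate $R$ is achievable if for every $\varepsilon>0$ and every sufficiently large $n$ there is a code of block length $n$ for $\lceil 2^{nR}\rceil$ semantics such that $\Pr(\hat W\ne w\mid W=w)\le\varepsilon$ for every semantic $w$,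 the context being independent of $W$. Then for all conditional probability mass functions $p(u\mid q_0)$ and $p(s\mid u,q_0)$ (in particular, when $s=f(u,q_0)$ is a deterministic function), every rate $$R< I(U;X\mid Q_2)+I(U;\tilde Q_2\mid Q_0),\qquad Q_2=(Q_0,\tilde Q_2),$$ is achievable, where the conditional mutual informations (in bits) are those of $(Q_0,\tilde Q_2,U,S,X)$ with joint law $p(q_0,\tilde q_2)\,p(u\mid q_0)\,p(s\mid u,q_0)\,p(x\mid s,q_0)$. -/

import Mathlib

namespace SemComm

/-- Probability that the random variable `A` takes the value `a`, where the finite sample space `Ω`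
carries the probability mass function `P`. -/
noncomputable def prob {Ω α : Type*} [Fintype Ω] (P : Ω → ℝ) (A : Ω → α) (a : α) : ℝ :=
  open Classical in ∑ ω, if A ω = a then P ω else 0

/-- Conditional mutual information `I(A;B|C)` in bits,
`∑ p(a,b,c) log₂ (p(a,b,c) p(c) / (p(a,c) p(b,c)))`, of finitely valued random variables on a finite
sample space with probability mass function `P`. Terms with `p(a,b,c) = 0` vanish; in the
others no denominator is zero. -/
noncomputable def condMutualInfo {Ω α β γ : Type*} [Fintype Ω] [Fintype α] [Fintype β] [Fintype γ]
    (P : Ω → ℝ) (A : Ω → α) (B : Ω → β) (C : Ω → γ) : ℝ :=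
  ∑ a, ∑ b, ∑ c,
    prob P (fun ω => (A ω, B ω, C ω)) (a, b, c) *
      Real.logb 2
        (prob P (fun ω => (A ω, B ω, C ω)) (a, b, c) * prob P C c /
          (prob P (fun ω => (A ω, C ω)) (a, c) * prob P (fun ω => (B ω, C ω)) (b, c)))

/-- A semantic channel over a noiseless physical channel, in which the sender knows the context
`Q₁ = Q₀` and the receiver knows the context `Q₂ = (Q₀, Q̃₂)`. -/
structure SemanticChannel (Q₀ Q₂ S X : Type*) where
  /-- the single-letter law `p(q₀, q̃₂)` of the context -/
  context : PMF (Q₀ × Q₂)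
  /-- the law `p(x | s, q₀)` by which a semantic letter is expressed as a message letter -/
  express : S → Q₀ → PMF X

/-- A block code of length `n` for `M` semantics: the sender sees the semantic and `q₀ⁿ`, the
receiver sees `xⁿ` and `q₂ⁿ = (q₀ⁿ, q̃₂ⁿ)`. -/
structure Code (Q₀ Q₂ S X : Type*) (M n : ℕ) where
  encode : Fin M → (Fin n → Q₀) → (Fin n → S)
  decode : (Fin n → X) → (Fin n → Q₀ × Q₂) → Fin M

section

variable {Q₀ Q₂ U S X : Type*} [Fintype Q₀] [Fintype Q₂] [Fintype U] [Fintype S] [Fintype X]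

/-- Probability that the receiver does not recover the semantic `w`, when the context is i.i.d. and
the message letters are produced memorylessly from the semantic codeword and the context. -/
noncomputable def SemanticChannel.errorProb (K : SemanticChannel Q₀ Q₂ S X) {M n : ℕ}
    (c : Code Q₀ Q₂ S X M n) (w : Fin M) : ℝ :=
  ∑ q : Fin n → Q₀ × Q₂, ∑ x : Fin n → X,
    if c.decode x q = w then 0
    else (∏ i, (K.context (q i)).toReal) *
      ∏ i, (K.express (c.encode w (fun j => (q j).1) i) (q i).1 (x i)).toReal

/-- The rate `R` (in bits per letter) is achievable: for all large block lengths there are codes for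
`⌈2^(nR)⌉` semantics whose error probability is arbitrarily small for every semantic, hence for
every law of the random semantic. -/
def SemanticChannel.Achievable (K : SemanticChannel Q₀ Q₂ S X) (R : ℝ) : Prop :=
  ∀ ε : ℝ, 0 < ε → ∀ᶠ n : ℕ in Filter.atTop,
    ∃ c : Code Q₀ Q₂ S X ⌈(2 : ℝ) ^ ((n : ℝ) * R)⌉₊ n, ∀ w, K.errorProb c w ≤ ε

/-- The joint law `p(q₀,q̃₂) p(u|q₀) p(s|u,q₀) p(x|s,q₀)` of `(Q₀, Q̃₂, U, S, X)`. -/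
noncomputable def SemanticChannel.jointLaw (K : SemanticChannel Q₀ Q₂ S X)
    (pU : Q₀ → PMF U) (pS : U → Q₀ → PMF S) : Q₀ × Q₂ × U × S × X → ℝ :=
  fun ω =>
    (K.context (ω.1, ω.2.1)).toReal * (pU ω.1 ω.2.2.1).toReal *
      (pS ω.2.2.1 ω.1 ω.2.2.2.1).toReal * (K.express ω.2.2.2.1 ω.1 ω.2.2.2.2).toReal

end

end SemComm

namespace SemComm

open Finset Filter Topology

/-! Given `Q₀`, the letter `U` is drawn independently of `Q̃₂`, so the second mutual information is
zero (`condMutualInfo_context`) and the target is I(U;X|Q₂). Given (U, Q₀), X is independent of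
`Q̃₂`, so the information density is log₂ (p(x|u,q₀) / p(x|q₀)) (`condMutualInfo_message`).
Codewords are maps from q₀ⁿ to pairs (uⁿ, sⁿ), chosen greedily after Feinstein
(`exists_maximal_code`), which bounds the error of every semantic directly. The receiver tests
whether the density exceeds nt, with R < t < I. The true codeword fails with probability at most mⁿ,
where m < 1 is a moment (`exists_sum_mul_rpow_lt_one`); earlier codewords pass by accident with
probability at most 2^(-nt) each, and there are at most 2^(nR) of them. -/

theorem sum_toReal_pmf {α : Type*} [Fintype α] (p : PMF α) : ∑ a, (p a).toReal = 1 := by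
  rw [← ENNReal.toReal_sum fun a _ => p.apply_ne_top a, ← tsum_fintype (L := .unconditional _), p.tsum_coe,
    ENNReal.toReal_one]

/-! ### Greedy coding with side information at the encoder -/

/-- A weighted average is attained or undercut by some point. -/
theorem exists_le_weighted_sum {B : Type*} [Fintype B] (p e : B → ℝ) (hp : ∀ b, 0 ≤ p b)
    (hp1 : ∑ b, p b = 1) : ∃ b, e b ≤ ∑ b', p b' * e b' := by
  have hne : (univ : Finset B).Nonempty := by
    rw [Finset.nonempty_iff_ne_empty]
    intro h
    simp [h] at hp1
  obtain ⟨b, -, hb⟩ := exists_min_image univ e hne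
  refine ⟨b, ?_⟩
  calc e b = ∑ b', p b' * e b := by rw [← sum_mul, hp1, one_mul]
    _ ≤ _ := sum_le_sum fun b' hb' => mul_le_mul_of_nonneg_left (hb b' hb') (hp b')

open Classical in
/-- The step of the maximal code construction: one more codeword `b`, a function of the side
information `π y`, can be added to the codewords already chosen. -/
theorem exists_next_codeword {C B Y : Type*} [Fintype C] [Fintype B] [Fintype Y]
    (π : Y → C) (W p' : B → Y → ℝ) (p : C → B → ℝ) (T : B → Y → Prop) (δ τ : ℝ)
    (hW : ∀ b y, 0 ≤ W b y) (hp : ∀ c b, 0 ≤ p c b) (hp1 : ∀ c, ∑ b, p c b = 1)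
    (hp' : ∀ b y, p' b y = p (π y) b * W b y)
    (hδ : ∑ y, ∑ b, (if T b y then 0 else p' b y) ≤ δ)
    (hτ : ∀ a : C → B, ∑ y, (if T (a (π y)) y then ∑ b, p' b y else 0) ≤ τ)
    (enc : ℕ → C → B) (k : ℕ) :
    ∃ a : C → B, ∑ y, (if T (a (π y)) y ∧ ∀ j < k, ¬ T (enc j (π y)) y then 0
      else W (a (π y)) y) ≤ δ + k * τ := by
  let bad : B → Y → ℝ := fun b y =>
    if T b y ∧ ∀ j < k, ¬ T (enc j (π y)) y then 0 else W b y
  -- The encoder knows c, so the averaging argument applies to each fibre of `π` separately.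
  have hex : ∀ c, ∃ b, ∑ y with π y = c, bad b y ≤
      ∑ b', p c b' * ∑ y with π y = c, bad b' y := fun c =>
    exists_le_weighted_sum (p c) _ (hp c) (hp1 c)
  choose a ha using hex
  refine ⟨a, ?_⟩
  have hp0 : ∀ b y, 0 ≤ p' b y := fun b y => by
    rw [hp']; exact mul_nonneg (hp _ _) (hW _ _)
  -- Union bound: a bad pair is rejected by the test, or its output is accepted by an earlier
  -- codeword. In the second case, summing over b leaves the output marginal, to which `hτ` applies.
  have hbad : ∀ b y, p (π y) b * bad b y ≤ (if T b y then 0 else p' b y) +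
      ∑ j ∈ range k, if T (enc j (π y)) y then p' b y else 0 := by
    intro b y
    have hs : ∀ j ∈ range k, 0 ≤ if T (enc j (π y)) y then p' b y else 0 := fun j _ => by
      split_ifs
      exacts [hp0 b y, le_rfl]
    simp only [bad]
    by_cases hT : T b y
    · by_cases hj : ∀ j < k, ¬ T (enc j (π y)) y
      · rw [if_pos ⟨hT, hj⟩, if_pos hT, mul_zero, zero_add]
        exact sum_nonneg hs
      · rw [if_neg fun h => hj h.2, if_pos hT, zero_add, ← hp']
        push Not at hj
        obtain ⟨j, hjk, hj⟩ := hj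
        calc p' b y = if T (enc j (π y)) y then p' b y else 0 := (if_pos hj).symm
          _ ≤ _ := single_le_sum hs (mem_range.2 hjk)
    · rw [if_neg fun h => hT h.1, if_neg hT, ← hp']
      exact le_add_of_nonneg_right (sum_nonneg hs)
  calc ∑ y, bad (a (π y)) y = ∑ c, ∑ y with π y = c, bad (a (π y)) y :=
        (sum_fiberwise _ _ _).symm
    _ = ∑ c, ∑ y with π y = c, bad (a c) y :=
        sum_congr rfl fun c _ => sum_congr rfl fun y hy => by rw [(mem_filter.1 hy).2]
    _ ≤ ∑ c, ∑ b, p c b * ∑ y with π y = c, bad b y := sum_le_sum fun c _ => ha c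
    _ = ∑ c, ∑ y with π y = c, ∑ b, p (π y) b * bad b y := by
        refine sum_congr rfl fun c _ => ?_
        simp only [mul_sum]
        rw [sum_comm]
        exact sum_congr rfl fun y hy => by rw [(mem_filter.1 hy).2]
    _ = ∑ y, ∑ b, p (π y) b * bad b y := sum_fiberwise _ _ _
    _ ≤ ∑ y, ∑ b, ((if T b y then 0 else p' b y) +
          ∑ j ∈ range k, if T (enc j (π y)) y then p' b y else 0) :=
        sum_le_sum fun y _ => sum_le_sum fun b _ => hbad b y
    _ = ∑ y, ∑ b, (if T b y then 0 else p' b y) +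
          ∑ j ∈ range k, ∑ y, if T (enc j (π y)) y then ∑ b, p' b y else 0 := by
        simp only [sum_add_distrib]
        congr 1
        rw [sum_comm (s := range k)]
        refine sum_congr rfl fun y _ => ?_
        rw [sum_comm]
        refine sum_congr rfl fun j _ => ?_
        split_ifs <;> simp
    _ ≤ δ + ∑ _j ∈ range k, τ := add_le_add hδ (sum_le_sum fun j _ => hτ _)
    _ = δ + k * τ := by simp

open Classical in
/-- Feinstein's maximal code construction for a channel whose encoder sees the part `π y` of the
output `y`: if the threshold test `T` rejects the true input with probability at most `δ` and accepts
a fixed input on an independent output with probability at most `τ`, then there are `M` codewords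
with error probability at most `ε` each, provided that `δ + k τ ≤ ε` for `k < M`.
Here `p' b y` is the joint law of input and output. -/
theorem exists_maximal_code {C B Y : Type*} [Fintype C] [Fintype B] [Fintype Y]
    (π : Y → C) (W p' : B → Y → ℝ) (p : C → B → ℝ) (T : B → Y → Prop) (δ τ ε : ℝ)
    (hW : ∀ b y, 0 ≤ W b y) (hp : ∀ c b, 0 ≤ p c b) (hp1 : ∀ c, ∑ b, p c b = 1)
    (hp' : ∀ b y, p' b y = p (π y) b * W b y)
    (hδ : ∑ y, ∑ b, (if T b y then 0 else p' b y) ≤ δ)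
    (hτ : ∀ a : C → B, ∑ y, (if T (a (π y)) y then ∑ b, p' b y else 0) ≤ τ)
    (M : ℕ) (hM : 0 < M) (hε : ∀ k < M, δ + k * τ ≤ ε) :
    ∃ (enc : Fin M → C → B) (dec : Y → Fin M),
      ∀ w, ∑ y, (if dec y = w then 0 else W (enc w (π y)) y) ≤ ε := by
  -- The bad event of w involves only indices j < w, so adding codewords later does not change it.
  have key : ∀ k ≤ M, ∃ enc : ℕ → C → B, ∀ w < k,
      ∑ y, (if T (enc w (π y)) y ∧ ∀ j < w, ¬ T (enc j (π y)) y then 0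
        else W (enc w (π y)) y) ≤ ε := by
    intro k
    induction k with
    | zero =>
      have : ∀ c, Nonempty B := fun c => by
        by_contra h
        rw [not_nonempty_iff] at h
        simpa using hp1 c
      exact fun _ => ⟨fun _ c => (this c).some, fun w hw => absurd hw (Nat.not_lt_zero w)⟩
    | succ k ih =>
      intro hk
      obtain ⟨enc, henc⟩ := ih (by omega)
      obtain ⟨a, ha⟩ := exists_next_codeword π W p' p T δ τ hW hp hp1 hp' hδ hτ enc k
      refine ⟨Function.update enc k a, fun w hw => ?_⟩
      have hlt : ∀ j < w, Function.update enc k a j = enc j := fun j hj =>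
        Function.update_of_ne (by omega) _ _
      have hall : ∀ y, (∀ j < w, ¬ T (Function.update enc k a j (π y)) y) ↔
          ∀ j < w, ¬ T (enc j (π y)) y := fun y =>
        forall₂_congr fun j hj => by rw [hlt j hj]
      simp only [hall]
      rcases Nat.lt_succ_iff_lt_or_eq.1 hw with h | rfl
      · rw [Function.update_of_ne h.ne]
        exact henc w h
      · rw [Function.update_self]
        exact ha.trans (hε w hk)
  obtain ⟨enc, henc⟩ := key M le_rfl
  -- Decode to the least accepted index; the value 0 when none is accepted is arbitrary.
  refine ⟨fun w => enc w, fun y =>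
    if h : ∃ j, j < M ∧ T (enc j (π y)) y then ⟨Nat.find h, (Nat.find_spec h).1⟩ else ⟨0, hM⟩,
    fun w => le_trans (sum_le_sum fun y _ => ?_) (henc w w.2)⟩
  by_cases hT : T (enc w (π y)) y ∧ ∀ j < (w : ℕ), ¬ T (enc j (π y)) y
  · have h : ∃ j, j < M ∧ T (enc j (π y)) y := ⟨w, w.2, hT.1⟩
    rw [if_pos hT]
    beta_reduce
    rw [dif_pos h, if_pos]
    refine Fin.ext ((Nat.find_eq_iff h).2 ⟨⟨w.2, hT.1⟩, fun j hj hc => hT.2 j hj hc.2⟩)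
  · rw [if_neg hT]
    split_ifs
    exacts [hW _ _, le_rfl]

/-! ### Exponential moments -/

/-- If a positive random variable has negative mean logarithm, then some positive power of it has
mean less than `1`. -/
theorem exists_sum_mul_rpow_lt_one {Ω : Type*} [Fintype Ω] (P r : Ω → ℝ)
    (hP : ∑ ω, P ω = 1) (hr : ∀ ω, P ω ≠ 0 → 0 < r ω)
    (hlog : ∑ ω, P ω * Real.log (r ω) < 0) :
    ∃ l : ℝ, 0 < l ∧ ∑ ω, P ω * r ω ^ l < 1 := by
  -- The moment equals 1 at l = 0 and its derivative there is the mean logarithm, so it drops below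
  -- 1 just to the right.
  have hd : HasDerivAt (fun l : ℝ => ∑ ω, P ω * r ω ^ l) (∑ ω, P ω * Real.log (r ω)) 0 := by
    refine HasDerivAt.fun_sum fun ω _ => ?_
    rcases eq_or_ne (P ω) 0 with h | h
    · simpa [h] using hasDerivAt_const (0 : ℝ) (0 : ℝ)
    · have := (Real.hasStrictDerivAt_const_rpow (hr ω h) 0).hasDerivAt.const_mul (P ω)
      simpa using this
  have hs := (hasDerivAt_iff_tendsto_slope.1 hd).mono_left
    (nhdsWithin_mono (0 : ℝ) (fun x (hx : 0 < x) => hx.ne') : 𝓝[>] (0 : ℝ) ≤ 𝓝[≠] 0)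
  obtain ⟨l, hl, hl0⟩ := ((hs.eventually (gt_mem_nhds hlog)).and self_mem_nhdsWithin).exists
  have hl0 : 0 < l := hl0
  refine ⟨l, hl0, ?_⟩
  rw [slope_def_field, sub_zero, div_neg_iff] at hl
  simp only [Real.rpow_zero, mul_one, hP] at hl
  rcases hl with h | h <;> linarith [h.1, h.2]

/-! ### Single-letter laws -/

section

variable {Q₀ Q₂ U S X : Type*} [Fintype Q₀] [Fintype Q₂] [Fintype U] [Fintype S] [Fintype X]

/-- The law `p(x | u, q₀)`. -/
noncomputable def SemanticChannel.law (K : SemanticChannel Q₀ Q₂ S X)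
    (pS : U → Q₀ → PMF S) (u : U) (q : Q₀) (x : X) : ℝ :=
  ∑ s, (pS u q s).toReal * (K.express s q x).toReal

/-- The law `p(x | q₀)`. -/
noncomputable def SemanticChannel.outputLaw (K : SemanticChannel Q₀ Q₂ S X)
    (pU : Q₀ → PMF U) (pS : U → Q₀ → PMF S) (q : Q₀) (x : X) : ℝ :=
  ∑ u, (pU q u).toReal * K.law pS u q x

set_option linter.unusedSectionVars false

variable (K : SemanticChannel Q₀ Q₂ S X) (pU : Q₀ → PMF U) (pS : U → Q₀ → PMF S)

theorem SemanticChannel.law_nonneg (u : U) (q : Q₀) (x : X) : 0 ≤ K.law pS u q x :=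
  sum_nonneg fun _ _ => mul_nonneg ENNReal.toReal_nonneg ENNReal.toReal_nonneg

theorem SemanticChannel.outputLaw_nonneg (q : Q₀) (x : X) : 0 ≤ K.outputLaw pU pS q x :=
  sum_nonneg fun _ _ => mul_nonneg ENNReal.toReal_nonneg (K.law_nonneg pS _ _ _)

theorem SemanticChannel.sum_law (u : U) (q : Q₀) : ∑ x, K.law pS u q x = 1 := by
  simp only [SemanticChannel.law]
  rw [sum_comm]
  simp only [← mul_sum, sum_toReal_pmf, mul_one]

theorem SemanticChannel.law_pos {u : U} {q : Q₀} {s : S} {x : X} (hs : pS u q s ≠ 0)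
    (hx : K.express s q x ≠ 0) : 0 < K.law pS u q x :=
  sum_pos' (fun _ _ => mul_nonneg ENNReal.toReal_nonneg ENNReal.toReal_nonneg)
    ⟨s, mem_univ _, mul_pos (ENNReal.toReal_pos hs (PMF.apply_ne_top _ _))
      (ENNReal.toReal_pos hx (PMF.apply_ne_top _ _))⟩

theorem SemanticChannel.outputLaw_pos {u : U} {q : Q₀} {x : X} (hu : pU q u ≠ 0)
    (h : 0 < K.law pS u q x) : 0 < K.outputLaw pU pS q x :=
  sum_pos' (fun _ _ => mul_nonneg ENNReal.toReal_nonneg (K.law_nonneg pS _ _ _))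
    ⟨u, mem_univ _, mul_pos (ENNReal.toReal_pos hu (PMF.apply_ne_top _ _)) h⟩

theorem SemanticChannel.jointLaw_nonneg (ω) : 0 ≤ K.jointLaw pU pS ω := by
  unfold SemanticChannel.jointLaw
  positivity

theorem SemanticChannel.law_pos_of_jointLaw_ne_zero {q₀ : Q₀} {q₂ : Q₂} {u : U} {s : S} {x : X}
    (h : K.jointLaw pU pS (q₀, q₂, u, s, x) ≠ 0) :
    0 < K.law pS u q₀ x ∧ 0 < K.outputLaw pU pS q₀ x := by
  simp only [SemanticChannel.jointLaw, mul_ne_zero_iff, ENNReal.toReal_ne_zero] at h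
  have hV := K.law_pos pS h.1.2.1 h.2.1
  exact ⟨hV, K.outputLaw_pos pU pS h.1.1.2.1 hV⟩

/-- The law of `(Q₀, Q̃₂, U, X)`. -/
theorem SemanticChannel.sum_jointLaw_s (q₀ : Q₀) (q₂ : Q₂) (u : U) (x : X) :
    ∑ s, K.jointLaw pU pS (q₀, q₂, u, s, x) =
      (K.context (q₀, q₂)).toReal * (pU q₀ u).toReal * K.law pS u q₀ x := by
  simp only [SemanticChannel.jointLaw, SemanticChannel.law, mul_sum, mul_assoc]

theorem SemanticChannel.sum_jointLaw : ∑ ω, K.jointLaw pU pS ω = 1 := by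
  have h := sum_toReal_pmf K.context
  rw [Fintype.sum_prod_type] at h
  simpa only [Fintype.sum_prod_type, SemanticChannel.jointLaw, mul_assoc, ← mul_sum,
    sum_toReal_pmf, mul_one] using h

/-! ### The two conditional mutual informations -/

theorem prob_eq_sum {α : Type*} (A : Q₀ × Q₂ × U × S × X → α) (a : α) [DecidableEq α]
    (P : Q₀ × Q₂ × U × S × X → ℝ) :
    prob P A a = ∑ q₀, ∑ q₂, ∑ u, ∑ x, ∑ s,
      if A (q₀, q₂, u, s, x) = a then P (q₀, q₂, u, s, x) else 0 := by
  simp only [prob, Fintype.sum_prod_type]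
  refine sum_congr rfl fun _ _ => sum_congr rfl fun _ _ => sum_congr rfl fun _ _ => ?_
  -- With s innermost, `sum_jointLaw_s` can eliminate it.
  rw [sum_comm]
  congr!

theorem SemanticChannel.condMutualInfo_message :
    condMutualInfo (K.jointLaw pU pS) (fun ω => ω.2.2.1) (fun ω => ω.2.2.2.2)
        (fun ω => (ω.1, ω.2.1)) =
      ∑ ω, K.jointLaw pU pS ω * Real.logb 2
        (K.law pS ω.2.2.1 ω.1 ω.2.2.2.2 / K.outputLaw pU pS ω.1 ω.2.2.2.2) := by
  classical
  have h1 : ∀ u x q₀ q₂, prob (K.jointLaw pU pS)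
      (fun ω => (ω.2.2.1, ω.2.2.2.2, (ω.1, ω.2.1))) (u, x, (q₀, q₂)) =
      (K.context (q₀, q₂)).toReal * (pU q₀ u).toReal * K.law pS u q₀ x := fun u x q₀ q₂ => by
    rw [prob_eq_sum]
    simp [ite_and, K.sum_jointLaw_s]
  have h2 : ∀ q₀ q₂, prob (K.jointLaw pU pS) (fun ω => (ω.1, ω.2.1)) (q₀, q₂) =
      (K.context (q₀, q₂)).toReal := fun q₀ q₂ => by
    rw [prob_eq_sum]
    simp [ite_and, K.sum_jointLaw_s, ← mul_sum, K.sum_law, sum_toReal_pmf]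
  have h3 : ∀ u q₀ q₂, prob (K.jointLaw pU pS) (fun ω => (ω.2.2.1, (ω.1, ω.2.1))) (u, (q₀, q₂)) =
      (K.context (q₀, q₂)).toReal * (pU q₀ u).toReal := fun u q₀ q₂ => by
    rw [prob_eq_sum]
    simp [ite_and, K.sum_jointLaw_s, ← mul_sum, K.sum_law]
  have h4 : ∀ x q₀ q₂, prob (K.jointLaw pU pS) (fun ω => (ω.2.2.2.2, (ω.1, ω.2.1)))
      (x, (q₀, q₂)) = (K.context (q₀, q₂)).toReal * K.outputLaw pU pS q₀ x := fun x q₀ q₂ => by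
    rw [prob_eq_sum]
    simp [ite_and, K.sum_jointLaw_s, ← mul_sum, mul_assoc, SemanticChannel.outputLaw]
  simp only [condMutualInfo, Fintype.sum_prod_type, h1, h2, h3, h4]
  have hR : ∀ q₀ q₂ u, ∑ s, ∑ x, K.jointLaw pU pS (q₀, q₂, u, s, x) *
      Real.logb 2 (K.law pS u q₀ x / K.outputLaw pU pS q₀ x) =
      ∑ x, (K.context (q₀, q₂)).toReal * (pU q₀ u).toReal * K.law pS u q₀ x *
      Real.logb 2 (K.law pS u q₀ x / K.outputLaw pU pS q₀ x) := fun q₀ q₂ u => by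
    rw [sum_comm]
    simp only [← sum_mul, K.sum_jointLaw_s]
  simp only [hR]
  have hL : ∀ u x q₀ q₂, (K.context (q₀, q₂)).toReal * (pU q₀ u).toReal * K.law pS u q₀ x *
      Real.logb 2 ((K.context (q₀, q₂)).toReal * (pU q₀ u).toReal * K.law pS u q₀ x *
        (K.context (q₀, q₂)).toReal / ((K.context (q₀, q₂)).toReal * (pU q₀ u).toReal *
        ((K.context (q₀, q₂)).toReal * K.outputLaw pU pS q₀ x))) =
      (K.context (q₀, q₂)).toReal * (pU q₀ u).toReal * K.law pS u q₀ x *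
      Real.logb 2 (K.law pS u q₀ x / K.outputLaw pU pS q₀ x) := fun u x q₀ q₂ => by
    rcases eq_or_ne (K.context (q₀, q₂)).toReal 0 with h | h
    · simp [h]
    rcases eq_or_ne (pU q₀ u).toReal 0 with h' | h'
    · simp [h']
    congr 2
    field_simp
  simp only [hL]
  rw [sum_congr rfl fun u _ => sum_comm, sum_comm]
  refine sum_congr rfl fun q₀ _ => ?_
  rw [sum_congr rfl fun u _ => sum_comm, sum_comm]

/-- Since the codeword depends on the context through `Q₀` only, `U` and `Q̃₂` are conditionally
independent given `Q₀`. -/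
theorem SemanticChannel.condMutualInfo_context :
    condMutualInfo (K.jointLaw pU pS) (fun ω => ω.2.2.1) (fun ω => ω.2.1) (fun ω => ω.1) = 0 := by
  classical
  have h1 : ∀ u q₂ q₀, prob (K.jointLaw pU pS) (fun ω => (ω.2.2.1, ω.2.1, ω.1)) (u, q₂, q₀) =
      (K.context (q₀, q₂)).toReal * (pU q₀ u).toReal := fun u q₂ q₀ => by
    rw [prob_eq_sum]
    simp [ite_and, K.sum_jointLaw_s, ← mul_sum, K.sum_law]
  have h2 : ∀ q₀, prob (K.jointLaw pU pS) (fun ω => ω.1) q₀ =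
      ∑ q₂, (K.context (q₀, q₂)).toReal := fun q₀ => by
    rw [prob_eq_sum, Fintype.sum_eq_single q₀ fun b hb => by simp [hb]]
    simp [K.sum_jointLaw_s, ← mul_sum, K.sum_law, sum_toReal_pmf]
  have h3 : ∀ u q₀, prob (K.jointLaw pU pS) (fun ω => (ω.2.2.1, ω.1)) (u, q₀) =
      (∑ q₂, (K.context (q₀, q₂)).toReal) * (pU q₀ u).toReal := fun u q₀ => by
    rw [prob_eq_sum]
    simp [ite_and, K.sum_jointLaw_s, ← mul_sum, ← sum_mul, K.sum_law]
  have h4 : ∀ q₂ q₀, prob (K.jointLaw pU pS) (fun ω => (ω.2.1, ω.1)) (q₂, q₀) =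
      (K.context (q₀, q₂)).toReal := fun q₂ q₀ => by
    rw [prob_eq_sum]
    simp [ite_and, K.sum_jointLaw_s, ← mul_sum, K.sum_law, sum_toReal_pmf]
  simp only [condMutualInfo, h1, h2, h3, h4]
  refine sum_eq_zero fun u _ => sum_eq_zero fun q₂ _ => sum_eq_zero fun q₀ _ => ?_
  set c := (K.context (q₀, q₂)).toReal * (pU q₀ u).toReal with hc
  set z := ∑ q₂, (K.context (q₀, q₂)).toReal
  -- Numerator and denominator agree, so the logarithm is that of 1, or of 0/0 = 0; both vanish.
  have : c * z / (z * (pU q₀ u).toReal * (K.context (q₀, q₂)).toReal) = (c * z) / (c * z) := by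
    rw [hc]; ring
  rw [this]
  rcases eq_or_ne (c * z) 0 with h | h
  · simp [h]
  · simp [div_self h]

/-! ### Codes of block length n -/

theorem sum_prod_pi {n : ℕ} {β : Type*} [Fintype β] (F : Fin n → β → ℝ) :
    ∑ b : Fin n → β, ∏ i, F i (b i) = ∏ i, ∑ b, F i b := by
  classical
  rw [prod_univ_sum, Fintype.piFinset_univ]

open Classical in
/-- The maximal code construction for block length `n`, with threshold `t` for the information
density per letter, and the probability of a small information density bounded by a moment of
order `l`. -/
theorem SemanticChannel.exists_code (n M : ℕ) (hM : 0 < M) (t l ε : ℝ) (hl : 0 < l)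
    (hε : ∀ k < M, (∑ ω, K.jointLaw pU pS ω * ((2 : ℝ) ^ t *
        K.outputLaw pU pS ω.1 ω.2.2.2.2 / K.law pS ω.2.2.1 ω.1 ω.2.2.2.2) ^ l) ^ n +
      k * ((2 : ℝ) ^ t)⁻¹ ^ n ≤ ε) :
    ∃ c : Code Q₀ Q₂ S X M n, ∀ w, K.errorProb c w ≤ ε := by
  set g : ℝ := (2 : ℝ) ^ t with hg
  have hg0 : 0 < g := by positivity
  let π : (Fin n → Q₀ × Q₂) × (Fin n → X) → Fin n → Q₀ := fun y i => (y.1 i).1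
  -- The input carries sⁿ as well as uⁿ: the greedy choice thus also fixes the randomness of
  -- p(s|u,q₀). `W` depends only on sⁿ, the test `T` only on uⁿ.
  let W : (Fin n → U × S) → (Fin n → Q₀ × Q₂) × (Fin n → X) → ℝ := fun b y =>
    (∏ i, (K.context (y.1 i)).toReal) *
      ∏ i, (K.express (b i).2 (y.1 i).1 (y.2 i)).toReal
  let p : (Fin n → Q₀) → (Fin n → U × S) → ℝ := fun c b =>
    ∏ i, (pU (c i) (b i).1).toReal * (pS (b i).1 (c i) (b i).2).toReal
  let T : (Fin n → U × S) → (Fin n → Q₀ × Q₂) × (Fin n → X) → Prop := fun b y =>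
    g ^ n * ∏ i, K.outputLaw pU pS (y.1 i).1 (y.2 i) < ∏ i, K.law pS (b i).1 (y.1 i).1 (y.2 i)
  let J : (Fin n → U × S) → (Fin n → Q₀ × Q₂) × (Fin n → X) → ℝ := fun b y =>
    ∏ i, K.jointLaw pU pS ((y.1 i).1, (y.1 i).2, (b i).1, (b i).2, y.2 i)
  have hJ : ∀ b y, J b y = p (π y) b * W b y := fun b y => by
    simp only [J, p, W, π, ← prod_mul_distrib, SemanticChannel.jointLaw]
    exact prod_congr rfl fun i _ => by ring
  have hJsum : ∀ y, ∑ b, J b y = (∏ i, (K.context (y.1 i)).toReal) *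
      ∏ i, K.outputLaw pU pS (y.1 i).1 (y.2 i) := fun y => by
    simp only [J]
    rw [sum_prod_pi (fun i (b : U × S) =>
      K.jointLaw pU pS ((y.1 i).1, (y.1 i).2, b.1, b.2, y.2 i)), ← prod_mul_distrib]
    refine prod_congr rfl fun i _ => ?_
    simp only [Fintype.sum_prod_type, K.sum_jointLaw_s, SemanticChannel.outputLaw, mul_sum,
      mul_assoc]
  suffices h : ∃ (enc : Fin M → (Fin n → Q₀) → Fin n → U × S) (dec : _ → Fin M),
      ∀ w, ∑ y, (if dec y = w then 0 else W (enc w (π y)) y) ≤ ε by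
    obtain ⟨enc, dec, h⟩ := h
    refine ⟨⟨fun w c i => (enc w c i).2, fun x q => dec (q, x)⟩,
      fun w => le_trans (le_of_eq ?_) (h w)⟩
    rw [Fintype.sum_prod_type]
    simp only [SemanticChannel.errorProb, W, π]
  refine exists_maximal_code π W J p T _ (g⁻¹ ^ n) ε ?_ ?_ ?_ hJ ?_ ?_ M hM hε
  · intro b y
    positivity
  · intro c b
    positivity
  · intro c
    simp only [p]
    rw [sum_prod_pi (fun i (b : U × S) => (pU (c i) b.1).toReal * (pS b.1 (c i) b.2).toReal)]
    simp [Fintype.sum_prod_type, ← mul_sum, sum_toReal_pmf]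
  -- Chernoff bound: where the test fails and `J` is positive, the product of ratios is at least 1,
  -- and so is its power l.
  · have hle : ∀ y b, (if T b y then 0 else J b y) ≤
        ∏ i, K.jointLaw pU pS ((y.1 i).1, (y.1 i).2, (b i).1, (b i).2, y.2 i) *
          (g * K.outputLaw pU pS (y.1 i).1 (y.2 i) / K.law pS (b i).1 (y.1 i).1 (y.2 i)) ^ l := by
      intro y b
      have hr : ∀ i, 0 ≤ g * K.outputLaw pU pS (y.1 i).1 (y.2 i) /
          K.law pS (b i).1 (y.1 i).1 (y.2 i) := fun i =>
        div_nonneg (mul_nonneg hg0.le (K.outputLaw_nonneg pU pS _ _)) (K.law_nonneg pS _ _ _)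
      rw [prod_mul_distrib]
      have hJ0 : 0 ≤ J b y := prod_nonneg fun i _ => K.jointLaw_nonneg pU pS _
      split_ifs with hT
      · exact mul_nonneg hJ0 (prod_nonneg fun i _ => Real.rpow_nonneg (hr i) _)
      rcases eq_or_ne (J b y) 0 with h0 | h0
      · rw [h0]
        exact mul_nonneg hJ0 (prod_nonneg fun i _ => Real.rpow_nonneg (hr i) _)
      refine le_mul_of_one_le_right hJ0 ?_
      rw [Real.finsetProd_rpow _ _ fun i _ => hr i, prod_div_distrib, prod_mul_distrib]
      refine Real.one_le_rpow ?_ hl.le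
      rw [one_le_div (prod_pos fun i _ => (K.law_pos_of_jointLaw_ne_zero pU pS
        (prod_ne_zero_iff.1 h0 i (mem_univ i))).1)]
      simpa [T] using hT
    calc _ ≤ ∑ y : (Fin n → Q₀ × Q₂) × (Fin n → X), ∑ b : Fin n → U × S, _ :=
          sum_le_sum fun y _ => sum_le_sum fun b _ => hle y b
      _ = _ := ?_
    rw [Fintype.sum_prod_type]
    have e1 := fun (q : Fin n → Q₀ × Q₂) (x : Fin n → X) => sum_prod_pi (fun i (b : U × S) =>
      K.jointLaw pU pS ((q i).1, (q i).2, b.1, b.2, x i) *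
          (g * K.outputLaw pU pS (q i).1 (x i) / K.law pS b.1 (q i).1 (x i)) ^ l)
    have e2 := fun (q : Fin n → Q₀ × Q₂) => sum_prod_pi (fun i (x : X) => ∑ b : U × S,
      K.jointLaw pU pS ((q i).1, (q i).2, b.1, b.2, x) *
          (g * K.outputLaw pU pS (q i).1 x / K.law pS b.1 (q i).1 x) ^ l)
    have e3 := sum_prod_pi (n := n) (fun _ (q : Q₀ × Q₂) => ∑ x, ∑ b : U × S,
      K.jointLaw pU pS (q.1, q.2, b.1, b.2, x) *
          (g * K.outputLaw pU pS q.1 x / K.law pS b.1 q.1 x) ^ l)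
    simp only [e1, e2, e3, prod_const, card_univ, Fintype.card_fin]
    congr 1
    simp only [Fintype.sum_prod_type]
    refine sum_congr rfl fun _ _ => sum_congr rfl fun _ _ => ?_
    rw [sum_comm]
    exact sum_congr rfl fun _ _ => sum_comm
  · intro a
    -- Change of measure: on acceptance the output law is at most g⁻ⁿ times the law under the
    -- codeword, whose total mass is 1.
    have hle : ∀ y, (if T (a (π y)) y then ∑ b, J b y else 0) ≤ g⁻¹ ^ n *
        ((∏ i, (K.context (y.1 i)).toReal) *
          ∏ i, K.law pS (a (fun j => (y.1 j).1) i).1 (y.1 i).1 (y.2 i)) := by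
      intro y
      have hV : 0 ≤ ∏ i, K.law pS (a (fun j => (y.1 j).1) i).1 (y.1 i).1 (y.2 i) :=
        prod_nonneg fun i _ => K.law_nonneg pS _ _ _
      split_ifs with hT
      · have hT' : g ^ n * ∏ i, K.outputLaw pU pS (y.1 i).1 (y.2 i) ≤
          ∏ i, K.law pS (a (fun j => (y.1 j).1) i).1 (y.1 i).1 (y.2 i) := le_of_lt hT
        rw [hJsum, mul_left_comm]
        refine mul_le_mul_of_nonneg_left ?_ (by positivity)
        rw [inv_pow, ← div_eq_inv_mul, le_div_iff₀ (by positivity), mul_comm]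
        exact hT'
      · positivity
    refine (sum_le_sum fun y _ => hle y).trans (le_of_eq ?_)
    rw [← mul_sum, Fintype.sum_prod_type]
    have e1 := fun (q : Fin n → Q₀ × Q₂) => sum_prod_pi (fun i (x : X) =>
      K.law pS (a (fun j => (q j).1) i).1 (q i).1 x)
    have e2 := sum_prod_pi (n := n) (fun _ (q : Q₀ × Q₂) => (K.context q).toReal)
    simp only [← mul_sum, e1, K.sum_law, prod_const_one, mul_one, e2, sum_toReal_pmf]

end

end SemComm

/-! ### Choice of the threshold -/

theorem theorem4 {Q₀ Q₂ U S X : Type*}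
    [Fintype Q₀] [Fintype Q₂] [Fintype U] [Fintype S] [Fintype X]
    (K : SemComm.SemanticChannel Q₀ Q₂ S X)
    (pU : Q₀ → PMF U) (pS : U → Q₀ → PMF S) (R : ℝ)
    (hR : R <
      SemComm.condMutualInfo (K.jointLaw pU pS)
          (fun ω => ω.2.2.1) (fun ω => ω.2.2.2.2) (fun ω => (ω.1, ω.2.1)) +
        SemComm.condMutualInfo (K.jointLaw pU pS)
          (fun ω => ω.2.2.1) (fun ω => ω.2.1) (fun ω => ω.1)) :
    K.Achievable R := by
  intro ε hε
  rw [K.condMutualInfo_context, add_zero] at hR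
  obtain ⟨t, hRt, ht⟩ := exists_between hR
  rw [K.condMutualInfo_message] at ht
  have hg : (0 : ℝ) < 2 ^ t := by positivity
  obtain ⟨l, hl, hl1⟩ := SemComm.exists_sum_mul_rpow_lt_one (K.jointLaw pU pS)
    (fun ω => (2 : ℝ) ^ t * K.outputLaw pU pS ω.1 ω.2.2.2.2 / K.law pS ω.2.2.1 ω.1 ω.2.2.2.2)
    (K.sum_jointLaw pU pS)
    (fun ω hω => by
      obtain ⟨hV, hZ⟩ := K.law_pos_of_jointLaw_ne_zero pU pS hω
      positivity)
    (by
      -- Summed over ω, this makes the mean logarithm log 2 · (t - I), which is negative.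
      have hterm : ∀ ω, K.jointLaw pU pS ω * Real.log ((2 : ℝ) ^ t *
          K.outputLaw pU pS ω.1 ω.2.2.2.2 / K.law pS ω.2.2.1 ω.1 ω.2.2.2.2) =
          Real.log 2 * (K.jointLaw pU pS ω * t - K.jointLaw pU pS ω * Real.logb 2
            (K.law pS ω.2.2.1 ω.1 ω.2.2.2.2 / K.outputLaw pU pS ω.1 ω.2.2.2.2)) := by
        intro ω
        rcases eq_or_ne (K.jointLaw pU pS ω) 0 with h | h
        · simp [h]
        obtain ⟨hV, hZ⟩ := K.law_pos_of_jointLaw_ne_zero pU pS h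
        have h2 : Real.log 2 ≠ 0 := (Real.log_pos one_lt_two).ne'
        rw [Real.log_div (by positivity) hV.ne', Real.log_mul hg.ne' hZ.ne',
          Real.log_rpow two_pos, Real.logb, Real.log_div hV.ne' hZ.ne']
        field_simp
        ring
      simp only [hterm]
      rw [← Finset.mul_sum, Finset.sum_sub_distrib, ← Finset.sum_mul, K.sum_jointLaw, one_mul]
      exact mul_neg_of_pos_of_neg (Real.log_pos one_lt_two) (by linarith))
  set m := ∑ ω, K.jointLaw pU pS ω * ((2 : ℝ) ^ t *
    K.outputLaw pU pS ω.1 ω.2.2.2.2 / K.law pS ω.2.2.1 ω.1 ω.2.2.2.2) ^ l with hm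
  have hm0 : 0 ≤ m := Finset.sum_nonneg fun ω _ => mul_nonneg (K.jointLaw_nonneg pU pS ω)
    (Real.rpow_nonneg (div_nonneg (mul_nonneg hg.le (K.outputLaw_nonneg pU pS _ _))
      (K.law_nonneg pS _ _ _)) _)
  have hlim : Filter.Tendsto (fun n : ℕ => m ^ n + ((2 : ℝ) ^ (R - t)) ^ n) Filter.atTop
      (nhds (0 + 0)) :=
    (tendsto_pow_atTop_nhds_zero_of_lt_one hm0 hl1).add
      (tendsto_pow_atTop_nhds_zero_of_lt_one (by positivity)
        (Real.rpow_lt_one_of_one_lt_of_neg one_lt_two (by linarith)))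
  rw [add_zero] at hlim
  filter_upwards [hlim.eventually (gt_mem_nhds hε)] with n hn
  refine K.exists_code pU pS n _ (Nat.ceil_pos.2 (by positivity)) t l ε hl fun k hk => ?_
  -- Only k earlier codewords compete, and k < ⌈2^(nR)⌉, so the rounding costs nothing.
  have hk' : (k : ℝ) ≤ 2 ^ ((n : ℝ) * R) := (Nat.lt_ceil.1 hk).le
  refine le_trans (add_le_add le_rfl ?_) hn.le
  calc (k : ℝ) * ((2 : ℝ) ^ t)⁻¹ ^ n ≤ 2 ^ ((n : ℝ) * R) * ((2 : ℝ) ^ t)⁻¹ ^ n := by gcongr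
    _ = ((2 : ℝ) ^ (R - t)) ^ n := by
      rw [mul_comm (n : ℝ) R, Real.rpow_mul two_pos.le, Real.rpow_natCast, ← mul_pow,
        Real.rpow_sub two_pos, div_eq_mul_inv]
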